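/- Let $m=n-1\ge 1$, and let $\mathrm{Cl}_{0,m}$ be the real Clifford algebra of $\mathbb R^{0,m}$ (scalar product $\langle v,w\rangle=-\sum_j v_jw_j$) with relation $v\cdot v=-\langle v,v\rangle$; so the standard basis vectors satisfy $e_j^2=1$ and anticommute. Let $S=S_{0,m}$ be a real irreducible $\mathrm{Cl}_{0,m}$-module, with representation $\rho:\mathrm{Cl}_{0,m}\to\mathrm{End}_{\mathbb R}(S)$. The Schur algebra $\mathcal C=\mathcal C_{0,m}$ consists of the endomorphisms of $S$ commuting with $\mathfrak{so}(m)$, i.e. with all $\rho(\tfrac14[v,w])$, $v,w\in\mathbb R^{0,m}$; the even Schur algebra $\mathcal C^\circ\subseteq\mathcal C$ consists of those elements that commute with all $\rho(v)$, $v\in\mathbb R^{0,m}$. An element $C\in\mathcal C$ has type $\tau(C)=-1$ if it anticommutes with all $\rho(v)$. Fix $1\le\iota\le m$. Embed $\mathrm{Cl}_{0,m-1}$ in $\mathrm{Cl}_{0,m}$ as the subalgebra generated by the $e_j$, $j\ne\iota$, let $\mathrm{Cl}^\circ_{0,m-1}$ be its even part and $\omega_{0,m-1}=e_1\cdots\widehat{e_\iota}\cdots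 e_m$ its volume form. Let $S^\pm$ be the $\pm1$-eigenspaces of $\rho(e_\iota)$. **Theorem 2.4.** One has $S=S^+\oplus S^-$, and both summands are non-zero if $m\ge2$. Let $\phi\in\mathrm{End}_{\mathbb R}(S)$ be $$\phi=\begin{cases}\rho(\omega_{0,m-1}) & \text{if } m\equiv 0 \pmod 2,\\ J & \text{if } m\equiv 3,7\pmod 8,\\ 0 & \text{if } m\equiv 1,5 \pmod 8,\end{cases}$$ where $J\in\mathcal C$ is any element of type $\tau(J)=-1$ which is a complex structure ($J^2=-\mathrm{Id}$) if $m\equiv3\pmod 8$, and a para-complex structure ($J^2=\mathrm{Id}$, with $\pm1$-eigenspaces of equal dimension) if $m\equiv 7\pmod 8$; such a $J$ exists. Then $\phi(S^\pm)\subseteq S^\mp$, and for every endomorphism $\varphi\in\mathrm{End}_{\mathbb R}(S)$ commuting with $\rho(\mathrm{Cl}^\circ_{0,m-1})$ there are $a,b,c,d\in\mathcal C^\circ$ such that, with respect to $S=S^+\oplus S^-$, $$\varphi=\begin{pmatrix} a & b\phi\\ c\phi & d\end{pmatrix}.$$ Here $a$ is uniquely determined by $\varphi$ if $S^+\neq0$,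 and $d$ is uniquely determined if $S^-\ne0$; so both are unique if $m\ge2$. If $m\not\equiv1\pmod 4$, then $b$ and $c$ are uniquely determined by $\varphi$ and $\phi$ as well. -/

import Mathlib

noncomputable section

namespace Spin

/-- The scalar square `⟨v, v⟩ = -(v₁² + ⋯ + v_m²)` of the space `ℝ^{0,m}` of signature `(0, m)`. -/
def scalarSquare (m : ℕ) : QuadraticForm ℝ (Fin m → ℝ) :=
  QuadraticMap.weightedSumSquares ℝ (fun _ : Fin m => (-1 : ℝ))

/-- The Clifford algebra `Cl_{0,m}`, with relation `v * v = -⟨v, v⟩`. -/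
abbrev Cl (m : ℕ) : Type := CliffordAlgebra (-(scalarSquare m))

/-- The embedding of `ℝ^{0,m}` in `Cl_{0,m}`. -/
def vec (m : ℕ) : (Fin m → ℝ) →ₗ[ℝ] Cl m := CliffordAlgebra.ι (-(scalarSquare m))

/-- The standard orthonormal vector `e_i`, as an element of `Cl_{0,m}`. -/
def e {m : ℕ} (i : Fin m) : Cl m := vec m (Pi.single i 1)

/-- The volume form `ω_{0,m} = e_1 ⋯ e_m`. -/
def volumeForm (m : ℕ) : Cl m := (List.ofFn (fun i : Fin m => e i)).prod

/-- The isometric embedding `ℝ^{0,k} → ℝ^{0,k+1}` onto the hyperplane `x_i = 0`. -/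
def hyperplane {k : ℕ} (i : Fin (k + 1)) :
    (-(scalarSquare k)) →qᵢ (-(scalarSquare (k + 1))) where
  toFun x := i.insertNth (0 : ℝ) x
  map_add' x y := by
    ext j
    refine Fin.succAboveCases i ?_ (fun l => ?_) j <;> simp
  map_smul' r x := by
    ext j
    refine Fin.succAboveCases i ?_ (fun l => ?_) j <;> simp
  map_app' x := by
    simp [scalarSquare, QuadraticMap.weightedSumSquares_apply, Fin.sum_univ_succAbove _ i]

/-- The induced embedding `Cl_{0,k} → Cl_{0,k+1}`, with image generated by the `e_j`, `j ≠ i`. -/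
def incl {k : ℕ} (i : Fin (k + 1)) : Cl k →ₐ[ℝ] Cl (k + 1) :=
  CliffordAlgebra.map (hyperplane i)

section Representation

variable (m : ℕ) (S : Type*) [AddCommGroup S] [Module ℝ S] [Module (Cl m) S]
  [IsScalarTower ℝ (Cl m) S]

/-- The representation `ρ_{0,m} : Cl_{0,m} → End_ℝ(S)`. -/
def rho : Cl m →ₐ[ℝ] Module.End ℝ S := Algebra.lsmul ℝ ℝ S

/-- The image `¼ [v, w]` in `Cl_{0,m}` of the element `v ∧ w` of `so(0, m)`. -/
def wedge (v w : Fin m → ℝ) : Cl m :=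
  (1 / 4 : ℝ) • (vec m v * vec m w - vec m w * vec m v)

/-- The Schur algebra `End_ℝ(S)^{so(0,m)}`. -/
def schurAlgebra : Subalgebra ℝ (Module.End ℝ S) :=
  Subalgebra.centralizer ℝ {T | ∃ v w : Fin m → ℝ, T = rho m S (wedge m v w)}

/-- The even Schur algebra: the elements of the Schur algebra that commute with Clifford
multiplication by vectors (type `τ = +1`). -/
def evenSchurAlgebra : Subalgebra ℝ (Module.End ℝ S) :=
  schurAlgebra m S ⊓ Subalgebra.centralizer ℝ (Set.range fun v => rho m S (vec m v))

variable {S}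

/-- The elements of the Schur algebra that anticommute with Clifford multiplication by vectors
(type `τ = -1`). -/
def IsOddSchur (C : Module.End ℝ S) : Prop :=
  C ∈ schurAlgebra m S ∧
    ∀ v : Fin m → ℝ, rho m S (vec m v) * C = -(C * rho m S (vec m v))

end Representation

section LinearAlgebra

variable {S : Type*} [AddCommGroup S] [Module ℝ S]

def IsComplexStructure (J : Module.End ℝ S) : Prop := J * J = -1

/-- An involution whose `±1`-eigenspaces have the same dimension. -/
def IsParaComplexStructure (J : Module.End ℝ S) : Prop :=
  J * J = 1 ∧ Module.rank ℝ (J.eigenspace 1) = Module.rank ℝ (J.eigenspace (-1))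

/-- `φ` is the block matrix `[[A, B], [C, D]]` with respect to the subspaces `P` and `N`:
`A : P → P`, `B : N → P`, `C : P → N`, `D : N → N`, where each of these maps is given as the
restriction of an endomorphism of `S`. -/
def IsBlockMatrix (P N : Submodule ℝ S) (φ A B C D : Module.End ℝ S) : Prop :=
  (∀ s ∈ P, A s ∈ P ∧ C s ∈ N ∧ φ s = A s + C s) ∧
    (∀ s ∈ N, B s ∈ P ∧ D s ∈ N ∧ φ s = B s + D s)

end LinearAlgebra

section Restriction

variable {k : ℕ} (i : Fin (k + 1)) (S : Type*) [AddCommGroup S] [Module ℝ S]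
  [Module (Cl (k + 1)) S] [IsScalarTower ℝ (Cl (k + 1)) S]

/-- The `+1`-eigenspace of `e_i` on `S`. -/
def posSpace : Submodule ℝ S := Module.End.eigenspace (rho (k + 1) S (e i)) 1

/-- The `-1`-eigenspace of `e_i` on `S`. -/
def negSpace : Submodule ℝ S := Module.End.eigenspace (rho (k + 1) S (e i)) (-1)

variable {S}

/-- Invariance under the even part of `Cl_{0,k}`, embedded in `Cl_{0,k+1}` by omitting `e_i`. -/
def IsInvariant (φ : Module.End ℝ S) : Prop :=
  ∀ c ∈ CliffordAlgebra.even (-(scalarSquare k)),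
    rho (k + 1) S (incl i c) * φ = φ * rho (k + 1) S (incl i c)

/-- The off-diagonal map `ϕ`, according to the residue of `k + 1`: the volume form of `Cl_{0,k}`,
or a complex or para-complex structure of type `τ = -1` in the Schur algebra, or zero. -/
def IsOffDiagonalMap (ϕ : Module.End ℝ S) : Prop :=
  ((k + 1) % 2 = 0 → ϕ = rho (k + 1) S (incl i (volumeForm k))) ∧
    ((k + 1) % 8 = 3 → IsOddSchur (k + 1) ϕ ∧ IsComplexStructure ϕ) ∧
    ((k + 1) % 8 = 7 → IsOddSchur (k + 1) ϕ ∧ IsParaComplexStructure ϕ) ∧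
    ((k + 1) % 8 = 1 ∨ (k + 1) % 8 = 5 → ϕ = 0)

end Restriction

end Spin

end

/-! Write `gen S j` for the action of `e_j`. An invariant `φ` commutes with all products `e_l e_j`,
`l, j ≠ i`, and these preserve both eigenspaces of `e_i`, while a single `e_j` with `j ≠ i`
exchanges them. Hence a diagonal block of `φ`, copied to the other eigenspace by conjugation with
`e_j`, becomes an endomorphism commuting with every generator (`exists_extension`). This gives `a`
and `d`.

If `m ≢ 1 (mod 4)`, the off-diagonal map `ϕ` exchanges the eigenspaces, commutes with the `e_l e_j`
and satisfies `ϕ² = ±1`. The same argument applied to `φ ϕ` therefore gives `b` and `c`. If `m ≡ 1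
(mod 4)`, the full volume element is central with square `1`, hence `±1` by Schur's lemma. So `e_i`
acts as plus or minus the volume form of the hyperplane, `φ` commutes with it, and the off-diagonal
blocks vanish (`IsInvariant.commute_gen`). Uniqueness holds because an element of the even Schur
algebra is determined by its value at one nonzero vector (`eq_of_evenSchur_of_apply_eq`).

The harder part is the existence of `J` for `m ≡ 3, 7 (mod 8)`. It is proved without classifying
Clifford algebras, for irreducible images of idempotents: starting from complex conjugation
(`hasConjugation_zero_one`), `add_pair` adds one generator of each sign and `flip_four` turns four
negative generators into positive ones, which together give periodicity `8`. -/

namespace Spin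

open Module

/-! ### Sign rules for anticommuting elements. -/

section Semiconj

variable {R : Type*} [Ring R]

/-- `x` and `y` anticommute. -/
def Anticommute (x y : R) : Prop := SemiconjBy x y (-y)

theorem Anticommute.eq {x y : R} (h : Anticommute x y) : x * y = -(y * x) := by
  rw [SemiconjBy.eq h, neg_mul]

theorem anticommute_iff {x y : R} : Anticommute x y ↔ x * y = -(y * x) := by
  rw [Anticommute, SemiconjBy, neg_mul]

theorem Anticommute.symm {x y : R} (h : Anticommute x y) : Anticommute y x := by
  rw [anticommute_iff, h.eq, neg_neg]

theorem Anticommute.commute_mul {x y z : R} (hy : Anticommute x y) (hz : Anticommute x z) :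
    Commute x (y * z) := by
  have h := SemiconjBy.mul_right hy hz
  rwa [neg_mul_neg] at h

theorem Anticommute.mul_right {x y z : R} (hy : Anticommute x y) (hz : Commute x z) :
    Anticommute x (y * z) := by
  have h := SemiconjBy.mul_right hy hz
  rwa [neg_mul] at h

theorem Anticommute.mul_left_right {x y z : R} (hy : Commute x y) (hz : Anticommute x z) :
    Anticommute x (y * z) := by
  have h := SemiconjBy.mul_right hy hz
  rwa [mul_neg] at h

theorem mul_self_mul_of_anticommute {x y : R} (h : Anticommute x y) :
    (x * y) * (x * y) = -((x * x) * (y * y)) := by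
  rw [mul_assoc, ← mul_assoc y x y, h.symm.eq]
  noncomm_ring

theorem mul_self_mul_of_commute {x y : R} (h : Commute x y) :
    (x * y) * (x * y) = (x * x) * (y * y) := h.symm.mul_mul_mul_comm x y

end Semiconj

/-! ### Endomorphisms anticommuting with all generators of an irreducible Clifford action. -/

section Conjugation

variable {V : Type*} [AddCommGroup V] [Module ℝ V]

/-- Two lists of pairwise anticommuting endomorphisms, with squares `1` and `-1` respectively. -/
structure IsCliffordPair (A B : List (End ℝ V)) : Prop where
  pos : ∀ x ∈ A, x * x = 1
  neg : ∀ x ∈ B, x * x = -1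
  pairwise_pos : A.Pairwise Anticommute
  pairwise_neg : B.Pairwise Anticommute
  cross : ∀ x ∈ A, ∀ y ∈ B, Anticommute x y

/-- The image of the idempotent `P`, which commutes with `F`, has no proper `F`-invariant
subspaces. -/
structure IsIrreducibleCorner (F : List (End ℝ V)) (P : End ℝ V) : Prop where
  idem : P * P = P
  comm : ∀ x ∈ F, Commute x P
  irr : ∀ W : Submodule ℝ V, (∀ v ∈ W, P v = v) → (∀ x ∈ F, ∀ v ∈ W, x v ∈ W) →
    W = ⊥ ∨ ∀ v, P v = v → v ∈ W

/-- An endomorphism of the image of `P` that anticommutes with `F` and has square `s`. -/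
structure IsConjugation (F : List (End ℝ V)) (P : End ℝ V) (s : ℝ) (K : End ℝ V) : Prop where
  left : P * K = K
  right : K * P = K
  sq : K * K = s • P
  anti : ∀ x ∈ F, Anticommute K x

variable (V) in
/-- Every irreducible corner for `p` generators of square `1` and `q` generators of square `-1`
carries a conjugation of square `s`. -/
def HasConjugation (p q : ℕ) (s : ℝ) : Prop :=
  ∀ A B : List (End ℝ V), A.length = p → B.length = q → IsCliffordPair A B →
    ∀ P, IsIrreducibleCorner (A ++ B) P → ∃ K, IsConjugation (A ++ B) P s K

/-- The projection to the `1`-eigenspace of an involution `w` in the image of `P`. -/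
noncomputable def halfCorner (P w : End ℝ V) : End ℝ V := (1 / 2 : ℝ) • (P * (1 + w))

theorem halfCorner_apply (P w : End ℝ V) (v : V) :
    halfCorner P w v = (1 / 2 : ℝ) • (P v + P (w v)) := by
  simp [halfCorner]

section Half

variable {P w g : End ℝ V}

theorem halfCorner_apply_eq_iff (hP : P * P = P) (hw : w * w = 1) (hPw : Commute w P) (v : V) :
    halfCorner P w v = v ↔ P v = v ∧ w v = v := by
  have h1 : ∀ v, P (P v) = P v := fun v => congrArg (· v) hP
  have h2 : ∀ v, w (w v) = v := fun v => congrArg (· v) hw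
  have h3 : ∀ v, w (P v) = P (w v) := fun v => congrArg (· v) hPw.eq
  rw [halfCorner_apply]
  constructor
  · intro h
    constructor
    · rw [← h]; simp [h1]
    · rw [← h]; simp [h2, h3, add_comm]
  · rintro ⟨h, h'⟩
    rw [h', h, ← two_smul ℝ v, smul_smul]; norm_num

theorem halfCorner_idem (hP : P * P = P) (hw : w * w = 1) (hPw : Commute w P) :
    halfCorner P w * halfCorner P w = halfCorner P w := by
  have h : P * (1 + w) * (P * (1 + w)) = (2 : ℝ) • (P * (1 + w)) := by
    have h1 : (1 + w) * P = P * (1 + w) := by rw [mul_add, add_mul, hPw.eq, one_mul, mul_one]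
    have h2 : (1 + w) * (1 + w) = (2 : ℝ) • (1 + w) := by
      rw [mul_add, add_mul, add_mul, hw, two_smul]; noncomm_ring
    rw [mul_assoc, ← mul_assoc (1 + w) P, h1, mul_assoc P (1 + w), h2, ← mul_assoc, hP,
      mul_smul_comm]
  rw [halfCorner, smul_mul_smul_comm, h, smul_smul]; norm_num

theorem commute_halfCorner {x : End ℝ V} (h : Commute x P) (hw : Commute x w) :
    Commute x (halfCorner P w) :=
  (h.mul_right ((Commute.one_right x).add_right hw)).smul_right _

theorem mul_halfCorner (hw : w * w = 1) (hPw : Commute w P) :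
    w * halfCorner P w = halfCorner P w := by
  rw [halfCorner, mul_smul_comm, ← mul_assoc, hPw.eq, mul_assoc, mul_add, hw, mul_one, add_comm]

theorem halfCorner_mul (hw : w * w = 1) (hPw : Commute w P) :
    halfCorner P w * w = halfCorner P w := by
  rw [← (commute_halfCorner hPw (Commute.refl w)).eq, mul_halfCorner hw hPw]

theorem halfCorner_add_conj (hg : g * g = 1) (hgP : Commute g P) (hgw : Anticommute g w) :
    halfCorner P w + g * halfCorner P w * g = P := by
  have h : g * (P * (1 + w)) * g = P * (1 - w) := by
    have h1 : (1 + w) * g = g * (1 - w) := by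
      rw [mul_sub, hgw.eq, mul_one, add_mul, one_mul, sub_neg_eq_add]
    rw [mul_assoc, mul_assoc, h1, ← mul_assoc P, ← hgP.eq, ← mul_assoc, ← mul_assoc, hg, one_mul]
  rw [halfCorner, mul_smul_comm, smul_mul_assoc, h, ← smul_add, ← mul_add,
    show (1 + w) + (1 - w) = (2 : ℝ) • (1 : End ℝ V) by rw [two_smul]; abel, mul_smul_comm,
    smul_smul, mul_one]
  norm_num

/-- The image of `halfCorner P w` is irreducible for `F'` once `W ⊔ g W` is `F`-invariant for each
`F'`-invariant subspace `W`. -/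
theorem IsIrreducibleCorner.halfCorner {F F' : List (End ℝ V)} (h : IsIrreducibleCorner F P)
    (hw : w * w = 1) (hwP : Commute w P) (hgP : Commute g P)
    (hgw : Anticommute g w) (hF' : ∀ x ∈ F', Commute x P ∧ Commute x w)
    (hF : ∀ W : Submodule ℝ V, (∀ v ∈ W, w v = v) → (∀ x ∈ F', ∀ v ∈ W, x v ∈ W) →
      ∀ x ∈ F, ∀ v ∈ W, x v ∈ W ⊔ W.map g ∧ x (g v) ∈ W ⊔ W.map g) :
    IsIrreducibleCorner F' (halfCorner P w) where
  idem := halfCorner_idem h.idem hw hwP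
  comm x hx := commute_halfCorner (hF' x hx).1 (hF' x hx).2
  irr W hW hWF := by
    have key := halfCorner_apply_eq_iff h.idem hw hwP
    have hgw' : ∀ v, w v = v → w (g v) = -g v := fun v hv => by
      have := congrArg (· v) hgw.symm.eq
      simpa [hv] using this
    have hgP' : ∀ v, g (P v) = P (g v) := fun v => congrArg (· v) hgP.eq
    -- `W` lies in the `1`-eigenspace of `w` and `g W` in the `-1`-eigenspace. If their sum is the
    -- whole image of `P`, a vector fixed by `w` has no component in `g W`.
    have hU := h.irr (W ⊔ W.map g) ?_ ?_
    · rcases hU with hU | hU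
      · left
        exact le_bot_iff.1 (hU ▸ le_sup_left)
      · right
        intro v hv
        obtain ⟨hv1, hv2⟩ := (key v).1 hv
        obtain ⟨y, hy, z, hz, rfl⟩ := Submodule.mem_sup.1 (hU v hv1)
        obtain ⟨z, hz, rfl⟩ := hz
        have hy2 := ((key y).1 (hW y hy)).2
        have hz2 := hgw' z ((key z).1 (hW z hz)).2
        rw [map_add, hy2, hz2] at hv2
        have h0 : g z = 0 := by
          have h2 : (2 : ℝ) • g z = 0 := by
            rw [two_smul]
            nth_rewrite 1 [← add_left_cancel hv2]
            rw [neg_add_cancel]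
          exact (smul_eq_zero.1 h2).resolve_left two_ne_zero
        rw [h0, add_zero]; exact hy
    · intro v hv
      obtain ⟨y, hy, z, hz, rfl⟩ := Submodule.mem_sup.1 hv
      obtain ⟨z, hz, rfl⟩ := hz
      rw [map_add, ((key y).1 (hW y hy)).1, ← hgP', ((key z).1 (hW z hz)).1]
    · intro x hx v hv
      have hx' := hF W (fun v hv => ((key v).1 (hW v hv)).2) hWF x hx
      obtain ⟨y, hy, z, hz, rfl⟩ := Submodule.mem_sup.1 hv
      obtain ⟨z, hz, rfl⟩ := hz
      rw [map_add]
      exact add_mem (hx' y hy).1 (hx' z hz).2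

end Half

/-- The single generator `b` is a complex structure, and irreducibility makes the image of `P` a
complex line `ℝ v ⊕ ℝ b v`; `K` is complex conjugation on it. -/
theorem hasConjugation_zero_one : HasConjugation V 0 1 1 := by
  intro A B hA hB hAB P hP
  obtain rfl := List.length_eq_zero_iff.1 hA
  obtain ⟨b, rfl⟩ := List.length_eq_one_iff.1 hB
  have hb : ∀ v, b (b v) = -v := fun v => congrArg (· v) (hAB.neg b (by simp))
  have hbP : ∀ v, b (P v) = P (b v) := fun v => congrArg (· v) (hP.comm b (by simp)).eq
  have hPP : ∀ v, P (P v) = P v := fun v => congrArg (· v) hP.idem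
  -- The zero corner counts as irreducible and is treated separately.
  by_cases h : ∀ v, P v = 0
  · refine ⟨0, by simp, by simp, ?_, fun x _ => by simp [anticommute_iff]⟩
    ext v; simp [h v]
  push Not at h
  obtain ⟨u, hu⟩ := h
  set v := P u with hv
  have hPv : P v = v := hPP u
  have hspan : ∀ x, ∃ α β : ℝ, P x = α • v + β • b v := by
    have hirr := hP.irr (Submodule.span ℝ {v, b v}) ?_ ?_
    · rcases hirr with h | h
      · exact absurd ((Submodule.span_eq_bot.1 h) v (by simp)) hu
      · intro x
        obtain ⟨α, β, h⟩ := Submodule.mem_span_pair.1 (h (P x) (hPP x))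
        exact ⟨α, β, h.symm⟩
    · intro x hx
      obtain ⟨α, β, rfl⟩ := Submodule.mem_span_pair.1 hx
      simp [hPv, ← hbP]
    · intro x hx y hy
      obtain rfl : x = b := by simpa using hx
      obtain ⟨α, β, rfl⟩ := Submodule.mem_span_pair.1 hy
      refine Submodule.mem_span_pair.2 ⟨-β, α, ?_⟩
      simp [hb, add_comm]
  -- `b² = -1` rules out a real eigenvector.
  have hnot : v ∉ Submodule.span ℝ {b v} := by
    intro hmem
    obtain ⟨c, hc⟩ := Submodule.mem_span_singleton.1 hmem
    have h1 : b v = -(c • v) := by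
      conv_lhs => rw [← hc]
      simp [hb]
    have h2 : (1 + c * c) • v = 0 := by
      rw [add_smul, one_smul, mul_smul]
      nth_rewrite 1 [← hc]
      rw [h1, smul_neg, neg_add_cancel]
    rcases smul_eq_zero.1 h2 with h | h
    · nlinarith [mul_self_nonneg c]
    · exact hu h
  obtain ⟨l, hl, hl'⟩ := Submodule.exists_le_ker_of_notMem hnot
  have hlb : l (b v) = 0 := hl' (Submodule.mem_span_singleton_self _)
  -- For `P x = α v + β b v` one has `l (P x) = α l v` and `l (b (P x)) = -β l v`, so `l` reads off
  -- the real part and minus the imaginary part.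
  set K : End ℝ V := (l v)⁻¹ • ((LinearMap.toSpanSingleton ℝ V v) ∘ₗ l ∘ₗ P +
    (LinearMap.toSpanSingleton ℝ V (b v)) ∘ₗ l ∘ₗ b ∘ₗ P) with hK
  have hKx : ∀ (x : V) (α β : ℝ), P x = α • v + β • b v → K x = α • v - β • b v := by
    intro x α β hx
    simp only [hK, LinearMap.smul_apply, LinearMap.add_apply, LinearMap.comp_apply, hx, map_add,
      map_smul, hb, hlb, map_neg, LinearMap.toSpanSingleton_apply, smul_eq_mul]
    match_scalars <;> field_simp <;> ring
  refine ⟨K, ?_, ?_, ?_, ?_⟩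
  · ext x
    obtain ⟨α, β, hx⟩ := hspan x
    simp [hKx x α β hx, hPv, ← hbP]
  · ext x
    obtain ⟨α, β, hx⟩ := hspan x
    rw [Module.End.mul_apply, hKx x α β hx, hKx (P x) α β ((hPP x).trans hx)]
  · ext x
    obtain ⟨α, β, hx⟩ := hspan x
    rw [Module.End.mul_apply, hKx x α β hx, hKx _ α (-β) (by simp [hPv, ← hbP, sub_eq_add_neg])]
    simp [hx]
  · intro y hy
    obtain rfl : y = b := by simpa using hy
    rw [anticommute_iff]
    ext x
    obtain ⟨α, β, hx⟩ := hspan x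
    rw [Module.End.mul_apply, hKx (y x) (-β) α (by rw [← hbP, hx]; simp [hb, add_comm])]
    simp [hKx x α β hx, hb]
    abel

/-- A pair `a, b` of opposite squares generates a `2 × 2` matrix algebra. The involution `w = a b`
commutes with the other generators, which act irreducibly on its `1`-eigenspace in the corner, and
`a` exchanges the two eigenspaces. A conjugation `K` on this half extends as `K - a K a`. -/
theorem HasConjugation.add_pair {p q : ℕ} {s : ℝ} (h : HasConjugation V p q s) :
    HasConjugation V (p + 1) (q + 1) s := by
  intro A' B' hA hB hAB P hP
  obtain ⟨a, A, rfl⟩ := List.exists_cons_of_length_eq_add_one hA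
  obtain ⟨b, B, rfl⟩ := List.exists_cons_of_length_eq_add_one hB
  have ha : a * a = 1 := hAB.pos a (by simp)
  have hb : b * b = -1 := hAB.neg b (by simp)
  have hab : Anticommute a b := hAB.cross a (by simp) b (by simp)
  have hA1 := List.pairwise_cons.1 hAB.pairwise_pos
  have hB1 := List.pairwise_cons.1 hAB.pairwise_neg
  have hxa : ∀ x ∈ A ++ B, Anticommute x a := by
    intro x hx
    rcases List.mem_append.1 hx with hx | hx
    · exact (hA1.1 x hx).symm
    · exact (hAB.cross a (by simp) x (by simp [hx])).symm
  have hxb : ∀ x ∈ A ++ B, Anticommute x b := by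
    intro x hx
    rcases List.mem_append.1 hx with hx | hx
    · exact hAB.cross x (by simp [hx]) b (by simp)
    · exact (hB1.1 x hx).symm
  have hAB' : IsCliffordPair A B :=
    ⟨fun x hx => hAB.pos x (by simp [hx]), fun x hx => hAB.neg x (by simp [hx]), hA1.2, hB1.2,
      fun x hx y hy => hAB.cross x (by simp [hx]) y (by simp [hy])⟩
  have haP : Commute a P := hP.comm a (by simp)
  have hbP : Commute b P := hP.comm b (by simp)
  set w := a * b with hw_def
  have hw : w * w = 1 := by
    rw [hw_def, mul_self_mul_of_anticommute hab, ha, hb, one_mul, neg_neg]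
  have hwP : Commute w P := haP.mul_left hbP
  have haw : Anticommute a w := Anticommute.mul_left_right (Commute.refl a) hab
  have hawb : a * w = b := by rw [hw_def, ← mul_assoc, ha, one_mul]
  have hxw : ∀ x ∈ A ++ B, Commute x w := fun x hx => (hxa x hx).commute_mul (hxb x hx)
  have hxP : ∀ x ∈ A ++ B, Commute x P := fun x hx =>
    hP.comm x (by rcases List.mem_append.1 hx with hx | hx <;> simp [hx])
  have haa : ∀ v, a (a v) = v := fun v => congrArg (· v) ha
  obtain ⟨K, hK⟩ := h A B (by simpa using hA) (by simpa using hB) hAB' (halfCorner P w) <| by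
    refine hP.halfCorner hw hwP haP haw (fun x hx => ⟨hxP x hx, hxw x hx⟩) ?_
    intro W hW hWF x hx v hv
    have hav : a v ∈ W.map a := Submodule.mem_map_of_mem hv
    have hx : x = a ∨ x = b ∨ x ∈ A ++ B := by
      simp only [List.cons_append, List.mem_cons, List.mem_append] at hx ⊢; tauto
    rcases hx with rfl | rfl | hx
    · exact ⟨Submodule.mem_sup_right hav,
        Submodule.mem_sup_left (by rw [haa]; exact hv)⟩
    · have h1 : ∀ u, x u = a (w u) := fun u => (congrArg (· u) hawb).symm
      have h2 : w (a v) = - a (w v) := congrArg (· v) haw.symm.eq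
      refine ⟨Submodule.mem_sup_right (by rw [h1, hW v hv]; exact hav),
        Submodule.mem_sup_left ?_⟩
      rw [h1, h2, map_neg, haa, hW v hv]; exact neg_mem hv
    · have h1 : x (a v) = - a (x v) := congrArg (· v) (hxa x hx).eq
      refine ⟨Submodule.mem_sup_left (hWF x hx v hv), Submodule.mem_sup_right ?_⟩
      rw [h1]
      exact neg_mem (Submodule.mem_map_of_mem (hWF x hx v hv))
  have hwK : w * K = K := by rw [← hK.left, ← mul_assoc, mul_halfCorner hw hwP]
  have hKw : K * w = K := by rw [← hK.right, mul_assoc, halfCorner_mul hw hwP]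
  -- `K` lives on the `1`-eigenspace of `w`, which `a` moves to the `-1`-eigenspace.
  have hKaK : K * a * K = 0 := by
    have h1 : K * a * K = -(K * a * K) := by
      calc K * a * K = K * w * a * K := by rw [hKw]
        _ = -(K * a * (w * K)) := by rw [mul_assoc K, haw.symm.eq]; noncomm_ring
        _ = -(K * a * K) := by rw [hwK]
    have h2 : (2 : ℝ) • (K * a * K) = 0 := by
      rw [two_smul]; nth_rewrite 1 [h1]; rw [neg_add_cancel]
    exact (smul_eq_zero.1 h2).resolve_left two_ne_zero
  have hPK : P * K = K := by
    rw [← hK.left, ← mul_assoc, halfCorner, mul_smul_comm, ← mul_assoc, hP.idem]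
  have hKP : K * P = K := by
    rw [← hK.right, mul_assoc, (commute_halfCorner (Commute.refl P) hwP.symm).symm.eq,
      halfCorner, mul_smul_comm, ← mul_assoc, hP.idem]
  -- The minus sign yields anticommutation with `a`; since the map commutes with `w`, it also
  -- anticommutes with `b = a w`.
  have hJa : Anticommute (K - a * K * a) a := by
    rw [anticommute_iff]
    calc (K - a * K * a) * a = K * a - a * K * (a * a) := by noncomm_ring
      _ = -((a * K - (a * a) * K * a)) := by rw [ha]; noncomm_ring
      _ = _ := by noncomm_ring
  have hJw : Commute (K - a * K * a) w := by
    refine Commute.sub_left (hKw.trans hwK.symm) ?_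
    calc a * K * a * w = -(a * (K * w) * a) := by rw [mul_assoc _ a w, haw.eq]; noncomm_ring
      _ = -(a * w * K * a) := by rw [hKw, mul_assoc a w, hwK]
      _ = w * (a * K * a) := by rw [haw.eq]; noncomm_ring
  refine ⟨K - a * K * a, ?_, ?_, ?_, ?_⟩
  · rw [mul_sub, hPK, ← mul_assoc, ← mul_assoc, ← haP.eq, mul_assoc a, hPK]
  · rw [sub_mul, hKP, mul_assoc _ a, haP.eq, ← mul_assoc, mul_assoc a, hKP]
  · calc (K - a * K * a) * (K - a * K * a)
        = K * K - (K * a * K) * a - a * (K * a * K) + a * K * (a * a) * K * a := by noncomm_ring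
      _ = K * K + a * (K * K) * a := by rw [hKaK, ha]; noncomm_ring
      _ = s • (halfCorner P w + a * halfCorner P w * a) := by
        rw [hK.sq, mul_smul_comm, smul_mul_assoc, smul_add]
      _ = s • P := by rw [halfCorner_add_conj ha haP haw]
  · intro x hx
    have hx : x = a ∨ x = b ∨ x ∈ A ++ B := by
      simp only [List.cons_append, List.mem_cons, List.mem_append] at hx ⊢; tauto
    rcases hx with rfl | rfl | hx
    · exact hJa
    · rw [← hawb]; exact hJa.mul_right hJw
    · have h1 := hK.anti x hx
      have h2 := hxa x hx
      refine Anticommute.symm ?_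
      rw [anticommute_iff]
      calc x * (K - a * K * a) = x * K - (x * a) * K * a := by noncomm_ring
        _ = x * K + a * (x * K) * a := by rw [h2.eq]; noncomm_ring
        _ = -(K * x) - a * K * (x * a) := by rw [h1.symm.eq]; noncomm_ring
        _ = -((K - a * K * a) * x) := by rw [h2.eq]; noncomm_ring

/-- On the `1`-eigenspace of `w` in the corner, the product `a c` is a complex structure acting
irreducibly; take its conjugation `K`. Here the extension must anticommute with `w` too, so it has
to exchange the eigenspaces: `a K - K a` does, and its square is `-(K² + a K² a) = -P`. -/
theorem hasConjugation_three_zero : HasConjugation V 3 0 (-1) := by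
  intro A B hA hB hAB P hP
  obtain rfl := List.length_eq_zero_iff.1 hB
  obtain ⟨w, a, c, rfl⟩ := List.length_eq_three.1 hA
  have hw : w * w = 1 := hAB.pos w (by simp)
  have ha : a * a = 1 := hAB.pos a (by simp)
  have hc : c * c = 1 := hAB.pos c (by simp)
  have hpw := hAB.pairwise_pos
  simp only [List.pairwise_cons, List.mem_cons, List.not_mem_nil, or_false, forall_eq_or_imp,
    forall_eq] at hpw
  have haw : Anticommute a w := hpw.1.1.symm
  have hcw : Anticommute c w := hpw.1.2.symm
  have hac : Anticommute a c := hpw.2.1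
  have hwP : Commute w P := hP.comm w (by simp)
  have haP : Commute a P := hP.comm a (by simp)
  have hcP : Commute c P := hP.comm c (by simp)
  have hbw : Commute (a * c) w := (haw.symm.commute_mul hcw.symm).symm
  have hab : a * (a * c) = c := by rw [← mul_assoc, ha, one_mul]
  have hab' : Anticommute a (a * c) := Anticommute.mul_left_right (Commute.refl a) hac
  have haa : ∀ v, a (a v) = v := fun v => congrArg (· v) ha
  obtain ⟨K, hK⟩ := hasConjugation_zero_one (V := V) [] [a * c] rfl rfl
    ⟨by simp, by simp [mul_self_mul_of_anticommute hac, ha, hc], by simp, by simp, by simp⟩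
    (halfCorner P w) <| by
    refine hP.halfCorner hw hwP haP haw (fun x hx => ?_) ?_
    · obtain rfl : x = a * c := by simpa using hx
      exact ⟨haP.mul_left hcP, hbw⟩
    intro W hW hWF x hx v hv
    have hb : a (c v) ∈ W := hWF (a * c) (by simp) v hv
    have hx : x = w ∨ x = a ∨ x = c := by simpa using hx
    rcases hx with rfl | rfl | rfl
    · have h1 : x (a v) = - a (x v) := congrArg (· v) haw.symm.eq
      rw [h1, hW v hv]
      exact ⟨Submodule.mem_sup_left hv,
        Submodule.mem_sup_right (neg_mem (Submodule.mem_map_of_mem hv))⟩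
    · exact ⟨Submodule.mem_sup_right (Submodule.mem_map_of_mem hv),
        Submodule.mem_sup_left (by rw [haa]; exact hv)⟩
    · have h1 : x (a v) = - a (x v) := congrArg (· v) hac.symm.eq
      refine ⟨Submodule.mem_sup_right ⟨_, hb, haa _⟩, Submodule.mem_sup_left ?_⟩
      rw [h1]; exact neg_mem hb
  have hwK : w * K = K := by rw [← hK.left, ← mul_assoc, mul_halfCorner hw hwP]
  have hKw : K * w = K := by rw [← hK.right, mul_assoc, halfCorner_mul hw hwP]
  have hKaK : K * a * K = 0 := by
    have h1 : K * a * K = -(K * a * K) := by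
      calc K * a * K = K * w * a * K := by rw [hKw]
        _ = -(K * a * (w * K)) := by rw [mul_assoc K, haw.symm.eq]; noncomm_ring
        _ = -(K * a * K) := by rw [hwK]
    have h2 : (2 : ℝ) • (K * a * K) = 0 := by
      rw [two_smul]; nth_rewrite 1 [h1]; rw [neg_add_cancel]
    exact (smul_eq_zero.1 h2).resolve_left two_ne_zero
  have hPK : P * K = K := by
    rw [← hK.left, ← mul_assoc, halfCorner, mul_smul_comm, ← mul_assoc, hP.idem]
  have hKP : K * P = K := by
    rw [← hK.right, mul_assoc, (commute_halfCorner (Commute.refl P) hwP.symm).symm.eq,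
      halfCorner, mul_smul_comm, ← mul_assoc, hP.idem]
  have hKb : Anticommute K (a * c) := hK.anti _ (by simp)
  have hJa : Anticommute (a * K - K * a) a := by
    rw [anticommute_iff]
    calc (a * K - K * a) * a = a * K * a - K * (a * a) := by noncomm_ring
      _ = -((a * a) * K - a * K * a) := by rw [ha]; noncomm_ring
      _ = _ := by noncomm_ring
  -- Both `a` and `K` anticommute with `a c`. Commuting with `a c` and anticommuting with `a` gives
  -- anticommutation with `c = a (a c)`.
  have hJb : Commute (a * K - K * a) (a * c) := by
    have h : ∀ x y b : End ℝ V, Anticommute x b → Anticommute y b → Commute (x * y) b :=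
      fun x y b hx hy => (hx.symm.commute_mul hy.symm).symm
    exact (h _ _ _ hab' hKb).sub_left (h _ _ _ hKb hab')
  refine ⟨a * K - K * a, ?_, ?_, ?_, ?_⟩
  · rw [mul_sub, ← mul_assoc, ← haP.eq, mul_assoc, hPK, ← mul_assoc, hPK]
  · rw [sub_mul, mul_assoc, hKP, mul_assoc, haP.eq, ← mul_assoc, hKP]
  · calc (a * K - K * a) * (a * K - K * a)
        = a * (K * a * K) - a * (K * K) * a - K * (a * a) * K + K * a * K * a := by noncomm_ring
      _ = -(K * K + a * (K * K) * a) := by rw [hKaK, ha]; noncomm_ring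
      _ = -(halfCorner P w + a * halfCorner P w * a) := by rw [hK.sq, one_smul]
      _ = (-1 : ℝ) • P := by rw [halfCorner_add_conj ha haP haw, neg_one_smul]
  · intro x hx
    have hx : x = w ∨ x = a ∨ x = c := by simpa using hx
    rcases hx with rfl | rfl | rfl
    · rw [anticommute_iff]
      calc (a * K - K * a) * x = a * (K * x) - K * (a * x) := by noncomm_ring
        _ = a * (x * K) + x * K * a := by
          rw [haw.eq, hKw, hwK, mul_neg, ← mul_assoc, hKw, sub_neg_eq_add]
        _ = -(x * (a * K - K * a)) := by rw [← mul_assoc a, haw.eq]; noncomm_ring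
    · exact hJa
    · rw [← hab]; exact hJa.mul_right hJb

/-- With `w = a b c d`, replacing `a, b, c, d` by `a w, b w, c w, d w` turns their squares from `1`
into `-1` and keeps all anticommutation relations. The product of the new four is again `w`, so both
families have the same invariant subspaces, and anything anticommuting with the new family commutes
with `w` and hence anticommutes with the old one. -/
theorem HasConjugation.flip_four {p q : ℕ} {s : ℝ} (h : HasConjugation V p (q + 4) s) :
    HasConjugation V (p + 4) q s := by
  intro A' B hA hB hAB P hP
  obtain ⟨a, A', rfl⟩ := List.exists_cons_of_length_eq_add_one hA
  obtain ⟨b, A', rfl⟩ := List.exists_cons_of_length_eq_add_one (Nat.succ.inj hA)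
  obtain ⟨c, A', rfl⟩ := List.exists_cons_of_length_eq_add_one
    (Nat.succ.inj (Nat.succ.inj hA))
  obtain ⟨d, A, rfl⟩ := List.exists_cons_of_length_eq_add_one
    (Nat.succ.inj (Nat.succ.inj (Nat.succ.inj hA)))
  set w := (a * b) * (c * d) with hw_def
  obtain ⟨hpos, hneg, hA1, hB1, hcross⟩ := hAB
  simp only [List.pairwise_cons, List.mem_cons, forall_eq_or_imp] at hpos hA1 hcross
  obtain ⟨ha, hb, hc, hd, hApos⟩ := hpos
  obtain ⟨⟨hab, hac, had, haA⟩, ⟨hbc, hbd, hbA⟩, ⟨hcd, hcA⟩, hdA, hAA⟩ := hA1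
  obtain ⟨haB, hbB, hcB, hdB, hAB⟩ := hcross
  have haw : Anticommute a w :=
    (Anticommute.mul_left_right (Commute.refl a) hab).mul_right (hac.commute_mul had)
  have hbw : Anticommute b w := (hab.symm.mul_right (Commute.refl b)).mul_right
    (hbc.commute_mul hbd)
  have hcw : Anticommute c w := Anticommute.mul_left_right (hac.symm.commute_mul hbc.symm)
    (Anticommute.mul_left_right (Commute.refl c) hcd)
  have hdw : Anticommute d w := Anticommute.mul_left_right (had.symm.commute_mul hbd.symm)
    (hcd.symm.mul_right (Commute.refl d))
  have habcd : Commute (a * b) (c * d) :=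
    ((hac.symm.commute_mul hbc.symm).symm.mul_right (had.symm.commute_mul hbd.symm).symm)
  have hw : w * w = 1 := by
    rw [hw_def, mul_self_mul_of_commute habcd, mul_self_mul_of_anticommute hab,
      mul_self_mul_of_anticommute hcd, ha, hb, hc, hd]
    simp
  have hxw : ∀ x ∈ A ++ B, Commute x w := by
    intro x hx
    rcases List.mem_append.1 hx with hx | hx
    · exact ((haA x hx).symm.commute_mul (hbA x hx).symm).mul_right
        ((hcA x hx).symm.commute_mul (hdA x hx).symm)
    · exact ((haB x hx).symm.commute_mul (hbB x hx).symm).mul_right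
        ((hcB x hx).symm.commute_mul (hdB x hx).symm)
  have hsq : ∀ x : End ℝ V, x * x = 1 → Anticommute x w → x * w * (x * w) = -1 := by
    intro x hx hxw
    rw [mul_self_mul_of_anticommute hxw, hx, hw, one_mul]
  have hanti : ∀ x y : End ℝ V, Anticommute x w → Anticommute y w → Anticommute x y →
      Anticommute (x * w) (y * w) := by
    intro x y hx hy hxy
    rw [anticommute_iff]
    calc x * w * (y * w) = x * (w * y) * w := by noncomm_ring
      _ = -((x * y) * (w * w)) := by rw [hy.symm.eq]; noncomm_ring
      _ = -(-((y * x) * (w * w))) := by rw [hxy.eq]; noncomm_ring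
      _ = y * (x * w) * w := by noncomm_ring
      _ = -(y * w * (x * w)) := by
        rw [mul_assoc y w, ← mul_assoc w x, hx.symm.eq]; noncomm_ring
  have hanti' : ∀ x y : End ℝ V, Commute x w → Anticommute x y → Anticommute x (y * w) :=
    fun x y hx hxy => hxy.mul_right hx
  have hrec : ∀ x : End ℝ V, x * w * w = x := fun x => by rw [mul_assoc, hw, mul_one]
  have hw' : (a * w) * (b * w) * ((c * w) * (d * w)) = w := by
    have h1 : ∀ x y : End ℝ V, Anticommute y w → (x * w) * (y * w) = -(x * y) := by
      intro x y hy
      calc x * w * (y * w) = x * (w * y) * w := by noncomm_ring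
        _ = -(x * (y * w * w)) := by rw [hy.symm.eq]; noncomm_ring
        _ = -(x * y) := by rw [hrec]
    rw [h1 a b hbw, h1 c d hdw, neg_mul_neg]
  set G : List (End ℝ V) := A ++ ((a * w) :: (b * w) :: (c * w) :: (d * w) :: B) with hG
  have hmem : ∀ x ∈ (a :: b :: c :: d :: A) ++ B,
      x ∈ G ∨ ∃ y ∈ G, x = y * w := by
    intro x hx
    simp only [List.cons_append, List.mem_cons, List.mem_append] at hx
    rcases hx with rfl | rfl | rfl | rfl | hx | hx
    · exact Or.inr ⟨_, by simp [hG], (hrec x).symm⟩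
    · exact Or.inr ⟨_, by simp [hG], (hrec x).symm⟩
    · exact Or.inr ⟨_, by simp [hG], (hrec x).symm⟩
    · exact Or.inr ⟨_, by simp [hG], (hrec x).symm⟩
    · exact Or.inl (by simp [hG, hx])
    · exact Or.inl (by simp [hG, hx])
  have haP := hP.comm a (by simp)
  have hbP := hP.comm b (by simp)
  have hcP := hP.comm c (by simp)
  have hdP := hP.comm d (by simp)
  have hwP : Commute w P := (haP.mul_left hbP).mul_left (hcP.mul_left hdP)
  have hpair : IsCliffordPair A ((a * w) :: (b * w) :: (c * w) :: (d * w) :: B) := by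
    refine ⟨hApos, ?_, hAA, ?_, ?_⟩
    · simp only [List.mem_cons, forall_eq_or_imp]
      exact ⟨hsq a ha haw, hsq b hb hbw, hsq c hc hcw, hsq d hd hdw, hneg⟩
    · simp only [List.pairwise_cons, List.mem_cons, forall_eq_or_imp]
      exact ⟨⟨hanti _ _ haw hbw hab, hanti _ _ haw hcw hac, hanti _ _ haw hdw had,
          fun x hx => (hanti' _ _ (hxw x (by simp [hx])) (haB x hx).symm).symm⟩,
        ⟨hanti _ _ hbw hcw hbc, hanti _ _ hbw hdw hbd,
          fun x hx => (hanti' _ _ (hxw x (by simp [hx])) (hbB x hx).symm).symm⟩,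
        ⟨hanti _ _ hcw hdw hcd,
          fun x hx => (hanti' _ _ (hxw x (by simp [hx])) (hcB x hx).symm).symm⟩,
        fun x hx => (hanti' _ _ (hxw x (by simp [hx])) (hdB x hx).symm).symm, hB1⟩
    · intro x hx
      have h1 := hxw x (by simp [hx])
      simp only [List.mem_cons, forall_eq_or_imp]
      exact ⟨hanti' _ _ h1 (haA x hx).symm, hanti' _ _ h1 (hbA x hx).symm,
        hanti' _ _ h1 (hcA x hx).symm, hanti' _ _ h1 (hdA x hx).symm, hAB x hx⟩
  obtain ⟨K, hK⟩ := h A ((a * w) :: (b * w) :: (c * w) :: (d * w) :: B) (by simpa using hA)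
    (by simp [hB]) hpair P <| by
    refine ⟨hP.idem, ?_, ?_⟩
    · intro x hx
      have hx : x = a * w ∨ x = b * w ∨ x = c * w ∨ x = d * w ∨ x ∈ A ∨ x ∈ B := by
        simp only [List.mem_cons, List.mem_append] at hx; tauto
      rcases hx with rfl | rfl | rfl | rfl | hx | hx
      · exact haP.mul_left hwP
      · exact hbP.mul_left hwP
      · exact hcP.mul_left hwP
      · exact hdP.mul_left hwP
      · exact hP.comm x (by simp [hx])
      · exact hP.comm x (by simp [hx])
    · intro W hW hWF
      refine hP.irr W hW fun x hx v hv => ?_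
      have hwW : ∀ v ∈ W, w v ∈ W := by
        intro v hv
        rw [← hw']
        exact hWF (a * w) (by simp) _ (hWF (b * w) (by simp) _
          (hWF (c * w) (by simp) _ (hWF (d * w) (by simp) _ hv)))
      rcases hmem x hx with hx | ⟨y, hy, rfl⟩
      · exact hWF x hx v hv
      · exact hWF y hy _ (hwW v hv)
  refine ⟨K, hK.left, hK.right, hK.sq, fun x hx => ?_⟩
  have hKw : Commute K w := by
    rw [← hw']
    exact ((hK.anti (a * w) (by simp)).commute_mul (hK.anti (b * w) (by simp))).mul_right
      ((hK.anti (c * w) (by simp)).commute_mul (hK.anti (d * w) (by simp)))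
  rcases hmem x hx with hx | ⟨y, hy, rfl⟩
  · exact hK.anti x hx
  · exact (hK.anti y hy).mul_right hKw

theorem HasConjugation.add_eight {p q : ℕ} {s : ℝ} (h : HasConjugation V p q s) :
    HasConjugation V (p + 8) q s :=
  h.add_pair.add_pair.add_pair.add_pair.flip_four

theorem hasConjugation_seven_mod_eight (l : ℕ) : HasConjugation V (8 * l + 7) 0 1 := by
  induction l with
  | zero =>
    -- The signatures run `(0, 1)`, `(3, 4)`, `(7, 0)`.
    exact (hasConjugation_zero_one.add_pair.add_pair.add_pair).flip_four
  | succ l ih => exact ih.add_eight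

theorem hasConjugation_three_mod_eight (l : ℕ) : HasConjugation V (8 * l + 3) 0 (-1) := by
  induction l with
  | zero => exact hasConjugation_three_zero
  | succ l ih => exact ih.add_eight

end Conjugation

/-! ### Commutation and squares of products of anticommuting elements. -/

section VolumeElement

variable {R : Type*} [Ring R]

theorem mul_prod_of_anticommute (x : R) (L : List R) (h : ∀ y ∈ L, Anticommute x y) :
    x * L.prod = (-1) ^ L.length * (L.prod * x) := by
  induction L with
  | nil => simp
  | cons y L ih =>
    rw [List.forall_mem_cons] at h
    rw [List.prod_cons, List.length_cons, ← mul_assoc, h.1.eq, neg_mul, mul_assoc, ih h.2,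
      ← mul_assoc y, ← ((Commute.neg_one_left y).pow_left L.length).eq, pow_succ]
    noncomm_ring

/-- Passing its own copy costs `x` no sign, so there are `L.length - 1` sign changes; the exponent
has the same parity. -/
theorem mul_prod_of_mem (x : R) (L : List R) (hL : L.Pairwise Anticommute) (hx : x ∈ L) :
    x * L.prod = (-1) ^ (L.length + 1) * (L.prod * x) := by
  induction L with
  | nil => simp at hx
  | cons y L ih =>
    rw [List.pairwise_cons] at hL
    rcases List.mem_cons.1 hx with rfl | hx
    · rw [List.prod_cons, List.length_cons]
      calc x * (x * L.prod) = (x * (-1) ^ L.length) * (L.prod * x) := by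
            rw [mul_prod_of_anticommute x L hL.1, mul_assoc]
        _ = (-1) ^ L.length * (x * L.prod * x) := by
            rw [← ((Commute.neg_one_left x).pow_left L.length).eq]; noncomm_ring
        _ = (-1) ^ (L.length + 1 + 1) * (x * L.prod * x) := by
            rw [pow_succ, pow_succ]; noncomm_ring
    · rw [List.prod_cons, List.length_cons, ← mul_assoc, (hL.1 x hx).symm.eq, neg_mul, mul_assoc,
        ih hL.2 hx, ← mul_assoc y, ← ((Commute.neg_one_left y).pow_left (L.length + 1)).eq,
        pow_succ _ (L.length + 1)]
      noncomm_ring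

theorem prod_mul_self (L : List R) (hL : L.Pairwise Anticommute) (h1 : ∀ x ∈ L, x * x = 1) :
    L.prod * L.prod = (-1) ^ (L.length.choose 2) := by
  induction L with
  | nil => simp
  | cons y L ih =>
    rw [List.pairwise_cons] at hL
    rw [List.forall_mem_cons] at h1
    have h := mul_prod_of_anticommute y L hL.1
    have h' : L.prod * y = (-1) ^ L.length * (y * L.prod) := by
      rw [h, ← mul_assoc, ← pow_add, Even.neg_one_pow ⟨_, rfl⟩, one_mul]
    rw [List.prod_cons, mul_assoc, ← mul_assoc L.prod, h', List.length_cons, Nat.choose_succ_succ',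
      Nat.choose_one_right, pow_add, ← ih hL.2 h1.2, mul_assoc, ← mul_assoc y,
      ← ((Commute.neg_one_left y).pow_left L.length).eq, mul_assoc, ← mul_assoc y,
      ← mul_assoc y, h1.1, one_mul]

end VolumeElement

/-! ### Extending a diagonal block to the whole space. -/

section Extension

variable {V : Type*} [AddCommGroup V] [Module ℝ V]

/-- The block `Q φ Q` of `φ`, with `Q` the projection to the `1`-eigenspace of `w = ±f i`, extends
to an endomorphism commuting with all `f l`. -/
theorem exists_extension {ι : Type*} (f : ι → End ℝ V) (i : ι) (w φ : End ℝ V)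
    (hsq : ∀ l, f l * f l = 1) (hw : w * w = 1) (hfi : Commute (f i) w)
    (hfw : ∀ a, Commute a w → Commute (f i) a)
    (hanti : ∀ l j, l ≠ j → Anticommute (f l) (f j))
    (hfl : ∀ l, l ≠ i → Anticommute (f l) w)
    (hφ : ∀ l j, l ≠ i → j ≠ i → Commute (f l * f j) φ) :
    ∃ a : End ℝ V, (∀ l, Commute (f l) a) ∧ ∀ s, w s = s → a s = halfCorner 1 w (φ s) := by
  set Q := halfCorner 1 w with hQ
  have hwQ : w * Q = Q := mul_halfCorner hw (Commute.one_right w)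
  have hQw : Q * w = Q := halfCorner_mul hw (Commute.one_right w)
  have hQs : ∀ s, w s = s → Q s = s := fun s hs =>
    (halfCorner_apply_eq_iff (one_mul 1) hw (Commute.one_right w) s).2 ⟨rfl, hs⟩
  have hQφw : Commute (Q * φ * Q) w := by
    rw [Commute, SemiconjBy, mul_assoc, hQw, ← mul_assoc, ← mul_assoc, hwQ]
  by_cases hj : ∃ j, j ≠ i
  · obtain ⟨j, hj⟩ := hj
    set g := f j with hg
    have hgw : Anticommute g w := hfl j hj
    have hgg : g * g = 1 := hsq j
    have hQg : ∀ s, w s = s → Q (g s) = 0 := by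
      intro s hs
      have h1 : w (g s) = -g (w s) := congrArg (· s) hgw.symm.eq
      rw [hQ, halfCorner_apply, h1, hs]
      simp
    have hgQφg : Commute (g * (Q * φ * Q) * g) w := by
      calc g * (Q * φ * Q) * g * w = -(g * ((Q * φ * Q) * w) * g) := by
            rw [mul_assoc _ g w, hgw.eq]; noncomm_ring
        _ = -(g * w * (Q * φ * Q) * g) := by rw [hQφw.eq]; noncomm_ring
        _ = w * (g * (Q * φ * Q) * g) := by rw [hgw.eq]; noncomm_ring
    have hcg : Commute g (Q * φ * Q + g * (Q * φ * Q) * g) := by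
      rw [Commute, SemiconjBy, mul_add, add_mul, mul_assoc _ g g, hgg, mul_one,
        mul_assoc g (Q * φ * Q) g, ← mul_assoc g g, hgg, one_mul, add_comm]
    -- The block on the `1`-eigenspace of `w` is transported to the `-1`-eigenspace by `g`. For `l ≠
    -- i, j`, write `f l = (f l g) g`, where `f l g` commutes with the block and anticommutes with
    -- `g`; the two signs cancel in the transported block.
    refine ⟨Q * φ * Q + g * (Q * φ * Q) * g, fun l => ?_, fun s hs => ?_⟩
    · by_cases hli : l = i
      · subst hli
        exact hfw _ (hQφw.add_left hgQφg)
      by_cases hlj : l = j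
      · rw [hlj]; exact hcg
      have hlg : Anticommute (f l) g := hanti l j hlj
      have hXw : Commute (f l * g) w := ((hfl l hli).symm.commute_mul hgw.symm).symm
      have hXQ : Commute (f l * g) Q := commute_halfCorner (Commute.one_right _) hXw
      have hX : Commute (f l * g) (Q * φ * Q) :=
        (hXQ.mul_right (hφ l j hli hj)).mul_right hXQ
      have hXg : Anticommute (f l * g) g :=
        (Anticommute.symm <| Anticommute.mul_right hlg.symm (Commute.refl g))
      have hXc : Commute (f l * g) (Q * φ * Q + g * (Q * φ * Q) * g) := by
        refine hX.add_right ?_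
        rw [mul_assoc]
        have h := SemiconjBy.mul_right hXg (SemiconjBy.mul_right hX hXg)
        rw [mul_neg, neg_mul_neg] at h
        exact h
      have : f l = f l * g * g := by rw [mul_assoc, hgg, mul_one]
      rw [this]
      exact hXc.mul_left hcg
    · simp [hQs s hs, hQg s hs]
  · push Not at hj
    refine ⟨Q * φ * Q, fun l => ?_, fun s hs => ?_⟩
    · rw [hj l]; exact hfw _ hQφw
    · simp [hQs s hs]

end Extension

/-! ### The standard generators and the volume form. -/

section Generators

variable {m : ℕ}

theorem e_mul_self (j : Fin m) : (e j : Cl m) * e j = 1 := by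
  rw [e, vec, CliffordAlgebra.ι_sq_scalar]
  have h : (-(scalarSquare m)) (Pi.single j (1 : ℝ)) = 1 := by
    simp [scalarSquare, QuadraticMap.weightedSumSquares_apply, Pi.single_apply]
  rw [h, map_one]

theorem e_anticommute {j l : Fin m} (h : j ≠ l) : Anticommute (e j : Cl m) (e l) := by
  rw [anticommute_iff, e, e, vec]
  apply CliffordAlgebra.ι_mul_ι_comm_of_isOrtho
  rw [QuadraticMap.isOrtho_def]
  simp only [scalarSquare, neg_apply, QuadraticMap.weightedSumSquares_apply,
    Pi.add_apply, smul_eq_mul, neg_mul, one_mul, Finset.sum_neg_distrib, neg_neg]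
  rw [← Finset.sum_add_distrib]
  refine Finset.sum_congr rfl fun x _ => ?_
  rcases eq_or_ne x j with rfl | hx
  · simp [h]
  · simp [hx]

theorem vec_eq_sum (v : Fin m → ℝ) : vec m v = ∑ j, v j • (e j : Cl m) := by
  conv_lhs => rw [← (Pi.basisFun ℝ (Fin m)).sum_repr v]
  simp [e]

theorem incl_e {k : ℕ} (i : Fin (k + 1)) (j : Fin k) : incl i (e j) = e (i.succAbove j) := by
  rw [incl, e, vec, CliffordAlgebra.map_apply_ι, e, vec]
  congr 1
  change (i.insertNth (0 : ℝ) (Pi.single j (1 : ℝ) : Fin k → ℝ) : Fin (k + 1) → ℝ) = _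
  ext l
  refine Fin.succAboveCases i ?_ (fun l => ?_) l
  · simp
  · simp [Pi.single_apply]

theorem incl_volumeForm {k : ℕ} (i : Fin (k + 1)) :
    incl i (volumeForm k) = (List.ofFn fun j => (e (i.succAbove j) : Cl (k + 1))).prod := by
  rw [volumeForm, map_list_prod, List.map_ofFn]
  congr 2
  ext j
  exact incl_e i j

theorem volumeForm_mem_even {k : ℕ} (hk : Even k) :
    volumeForm k ∈ CliffordAlgebra.even (-(scalarSquare k)) := by
  have h := SetLike.list_prod_ofFn_mem_graded
    (A := CliffordAlgebra.evenOdd (-(scalarSquare k))) (fun _ : Fin k => 1) (fun j => e j)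
    (fun j => CliffordAlgebra.ι_mem_evenOdd_one _ _)
  rw [List.sum_ofFn, Finset.sum_const, Finset.card_univ, Fintype.card_fin, nsmul_one,
    (ZMod.natCast_eq_zero_iff_even).2 hk] at h
  exact h

end Generators

/-! ### Schur algebras and Schur's lemma in terms of generators. -/

section Representation

variable {m : ℕ} {S : Type*} [AddCommGroup S] [Module ℝ S] [Module (Cl m) S]
  [IsScalarTower ℝ (Cl m) S]

variable (S) in
/-- Clifford multiplication by the standard basis vector `e_j`. -/
noncomputable def gen (j : Fin m) : End ℝ S := rho m S (e j)

theorem gen_mul_self (j : Fin m) : gen S j * gen S j = 1 := by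
  rw [gen, ← map_mul, e_mul_self, map_one]

theorem gen_gen_apply (j : Fin m) (s : S) : gen S j (gen S j s) = s :=
  congrArg (· s) (gen_mul_self (S := S) j)

theorem gen_anticommute {j l : Fin m} (h : j ≠ l) : Anticommute (gen S j) (gen S l) := by
  rw [anticommute_iff, gen, gen, ← map_mul, ← map_mul, (e_anticommute h).eq, map_neg]

theorem rho_vec_eq_sum (v : Fin m → ℝ) : rho m S (vec m v) = ∑ j, v j • gen S j := by
  simp [vec_eq_sum, gen]

theorem mem_evenSchurAlgebra_iff {T : End ℝ S} :
    T ∈ evenSchurAlgebra m S ↔ ∀ j : Fin m, Commute (gen S j) T := by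
  constructor
  · intro h j
    exact (Subalgebra.mem_centralizer_iff ℝ).1 h.2 _ ⟨Pi.single j 1, rfl⟩
  · intro h
    have hv : ∀ v, Commute (rho m S (vec m v)) T := fun v => by
      rw [rho_vec_eq_sum]
      exact Commute.sum_left _ _ _ fun j _ => (h j).smul_left _
    refine ⟨(Subalgebra.mem_centralizer_iff ℝ).2 ?_, (Subalgebra.mem_centralizer_iff ℝ).2 ?_⟩
    · rintro _ ⟨v, w, rfl⟩
      rw [wedge, map_smul, map_sub, map_mul, map_mul]
      exact ((((hv v).mul_left (hv w)).sub_left ((hv w).mul_left (hv v))).smul_left _).eq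
    · rintro _ ⟨v, rfl⟩
      exact (hv v).eq

theorem isOddSchur_iff {T : End ℝ S} : IsOddSchur m T ↔ ∀ j : Fin m, Anticommute (gen S j) T := by
  constructor
  · intro h j
    exact anticommute_iff.2 (h.2 (Pi.single j 1))
  · intro h
    have hv : ∀ v, Anticommute (rho m S (vec m v)) T := fun v => by
      rw [anticommute_iff, rho_vec_eq_sum, Finset.sum_mul, Finset.mul_sum,
        ← Finset.sum_neg_distrib]
      refine Finset.sum_congr rfl fun j _ => ?_
      rw [smul_mul_assoc, (h j).eq, mul_smul_comm, smul_neg]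
    refine ⟨(Subalgebra.mem_centralizer_iff ℝ).2 ?_, fun v => (hv v).eq⟩
    rintro _ ⟨v, w, rfl⟩
    rw [wedge, map_smul, map_sub, map_mul, map_mul]
    have h2 : ∀ v w, Commute (rho m S (vec m v) * rho m S (vec m w)) T := fun v w =>
      ((hv v).symm.commute_mul (hv w).symm).symm
    exact (((h2 v w).sub_left (h2 w v)).smul_left _).eq

theorem eq_bot_or_eq_top_of_invariant [IsSimpleModule (Cl m) S] (W : Submodule ℝ S)
    (hW : ∀ j : Fin m, ∀ s ∈ W, gen S j s ∈ W) : W = ⊥ ∨ W = ⊤ := by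
  have hc : ∀ c : Cl m, ∀ s ∈ W, c • s ∈ W := by
    intro c
    induction c using CliffordAlgebra.induction with
    | algebraMap r => intro s hs; rw [algebraMap_smul]; exact W.smul_mem r hs
    | ι v =>
      intro s hs
      change rho m S (vec m v) s ∈ W
      rw [rho_vec_eq_sum, LinearMap.sum_apply]
      exact W.sum_mem fun j _ => W.smul_mem _ (hW j s hs)
    | mul a b ha hb => intro s hs; rw [mul_smul]; exact ha _ (hb s hs)
    | add a b ha hb => intro s hs; rw [add_smul]; exact W.add_mem (ha s hs) (hb s hs)
  let U : Submodule (Cl m) S := { W with smul_mem' := fun c s hs => hc c s hs }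
  have hmem : ∀ s, s ∈ U ↔ s ∈ W := fun s => Iff.rfl
  rcases eq_bot_or_eq_top U with h | h
  · left
    ext s
    rw [← hmem, h, Submodule.mem_bot, Submodule.mem_bot]
  · right
    ext s
    rw [← hmem, h]
    simp

/-- Schur's lemma: the kernel of `a - b` is a Clifford submodule containing `s ≠ 0`. -/
theorem eq_of_evenSchur_of_apply_eq [IsSimpleModule (Cl m) S] {a b : evenSchurAlgebra m S} {s : S}
    (hs : s ≠ 0) (h : (a : End ℝ S) s = (b : End ℝ S) s) : a = b := by
  have hW := eq_bot_or_eq_top_of_invariant (m := m)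
    (LinearMap.ker ((a : End ℝ S) - (b : End ℝ S))) <| by
    intro j x hx
    have hab := mem_evenSchurAlgebra_iff.1 (sub_mem a.2 b.2) j
    have h1 : ((a : End ℝ S) - (b : End ℝ S)) (gen S j x) =
      gen S j (((a : End ℝ S) - (b : End ℝ S)) x) := congrArg (· x) hab.symm.eq
    rw [LinearMap.mem_ker] at hx ⊢
    rw [h1, hx, map_zero]
  rcases hW with hW | hW
  · exact absurd ((Submodule.eq_bot_iff _).1 hW s (by simp [h])) hs
  · exact Subtype.ext (sub_eq_zero.1 (LinearMap.ker_eq_top.1 hW))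

theorem eq_one_or_eq_neg_one_of_central [IsSimpleModule (Cl m) S] {z : End ℝ S}
    (hz : z * z = 1) (hc : ∀ j : Fin m, Commute (gen S j) z) : z = 1 ∨ z = -1 := by
  have hzz : ∀ s, z (z s) = s := fun s => congrArg (· s) hz
  rcases eq_bot_or_eq_top_of_invariant (m := m) (LinearMap.ker (z - 1)) (by
    intro j x hx
    have h1 : z (gen S j x) = gen S j (z x) := congrArg (· x) (hc j).symm.eq
    simp only [LinearMap.mem_ker, LinearMap.sub_apply, Module.End.one_apply, sub_eq_zero] at hx ⊢
    rw [h1, hx]) with h | h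
  · right
    ext s
    have h1 := (Submodule.eq_bot_iff _).1 h (z s + s) (by simp [hzz, add_comm])
    simpa using eq_neg_of_add_eq_zero_left h1
  · left
    exact sub_eq_zero.1 (LinearMap.ker_eq_top.1 h)

variable (S) in
theorem exists_anticommuting_of_hasConjugation [IsSimpleModule (Cl m) S] {s : ℝ}
    (h : HasConjugation S m 0 s) :
    ∃ J : End ℝ S, IsOddSchur m J ∧ J * J = s • 1 := by
  have hpair : IsCliffordPair (List.ofFn (gen S (m := m))) ([] : List (End ℝ S)) := by
    refine ⟨?_, by simp, ?_, by simp, by simp⟩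
    · simp [List.mem_ofFn, gen_mul_self]
    · rw [List.pairwise_ofFn]
      exact fun j l hjl => gen_anticommute hjl.ne
  -- The whole simple module is the corner of `P = 1`.
  obtain ⟨K, hK⟩ := h _ [] (by simp) rfl hpair 1 <| by
    refine ⟨mul_one 1, fun x _ => Commute.one_right x, fun W _ hWF => ?_⟩
    rcases eq_bot_or_eq_top_of_invariant (m := m) W
      (fun j => hWF _ (by simp [List.mem_ofFn])) with hW | hW
    · exact Or.inl hW
    · exact Or.inr (by simp [hW])
  exact ⟨K, isOddSchur_iff.2 fun j => (hK.anti _ (by simp [List.mem_ofFn])).symm, hK.sq⟩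

theorem isParaComplexStructure_of_anticommute {J g : End ℝ S} (hJ : J * J = 1) (hg : g * g = 1)
    (hgJ : Anticommute g J) : IsParaComplexStructure J := by
  refine ⟨hJ, LinearEquiv.rank_eq ?_⟩
  have hgg : ∀ s, g (g s) = s := fun s => congrArg (· s) hg
  have hJg : ∀ s, J (g s) = -g (J s) := fun s => congrArg (· s) hgJ.symm.eq
  have h1 : ∀ s ∈ J.eigenspace 1, g s ∈ J.eigenspace (-1) := by
    intro s hs
    rw [End.mem_eigenspace_iff] at hs ⊢
    rw [hJg, hs]; simp
  have h2 : ∀ s ∈ J.eigenspace (-1), g s ∈ J.eigenspace 1 := by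
    intro s hs
    rw [End.mem_eigenspace_iff] at hs ⊢
    rw [hJg, hs]; simp
  exact LinearEquiv.ofLinearMap (g.restrict h1) (g.restrict h2)
    (by ext s; simp [hgg]) (by ext s; simp [hgg])

end Representation

/-! ### The eigenspaces of `e_i`, the off-diagonal map and invariant endomorphisms. -/

section Restriction

variable {k : ℕ} {i : Fin (k + 1)} {S : Type*} [AddCommGroup S] [Module ℝ S]
  [Module (Cl (k + 1)) S] [IsScalarTower ℝ (Cl (k + 1)) S]

theorem mem_posSpace_iff {s : S} : s ∈ posSpace i S ↔ gen S i s = s := by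
  rw [posSpace, End.mem_eigenspace_iff, one_smul, gen]

theorem mem_negSpace_iff {s : S} : s ∈ negSpace i S ↔ gen S i s = -s := by
  rw [negSpace, End.mem_eigenspace_iff, neg_one_smul, gen]

variable (i S) in
theorem isCompl_posSpace_negSpace : IsCompl (posSpace i S) (negSpace i S) := by
  constructor
  · rw [Submodule.disjoint_def]
    intro s h1 h2
    rw [mem_posSpace_iff] at h1
    rw [mem_negSpace_iff, h1] at h2
    have h3 : (2 : ℝ) • s = 0 := by
      rw [two_smul]; nth_rewrite 1 [h2]; rw [neg_add_cancel]
    exact (smul_eq_zero.1 h3).resolve_left two_ne_zero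
  · rw [codisjoint_iff, eq_top_iff]
    intro s _
    refine Submodule.mem_sup.2 ⟨(1 / 2 : ℝ) • (s + gen S i s), ?_,
      (1 / 2 : ℝ) • (s - gen S i s), ?_, by module⟩
    · rw [mem_posSpace_iff, map_smul, map_add, gen_gen_apply, add_comm]
    · rw [mem_negSpace_iff, map_smul, map_sub, gen_gen_apply, ← smul_neg, neg_sub]

theorem map_negSpace_of_anticommute {ψ : End ℝ S} (h : Anticommute (gen S i) ψ) :
    (∀ s ∈ posSpace i S, ψ s ∈ negSpace i S) ∧ ∀ s ∈ negSpace i S, ψ s ∈ posSpace i S := by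
  have h1 : ∀ s, gen S i (ψ s) = -ψ (gen S i s) := fun s => congrArg (· s) h.eq
  refine ⟨fun s hs => ?_, fun s hs => ?_⟩
  · rw [mem_posSpace_iff] at hs
    rw [mem_negSpace_iff, h1, hs]
  · rw [mem_negSpace_iff] at hs
    rw [mem_posSpace_iff, h1, hs, map_neg, neg_neg]

theorem map_posSpace_of_commute {ψ : End ℝ S} (h : Commute (gen S i) ψ) :
    (∀ s ∈ posSpace i S, ψ s ∈ posSpace i S) ∧ ∀ s ∈ negSpace i S, ψ s ∈ negSpace i S := by
  have h1 : ∀ s, gen S i (ψ s) = ψ (gen S i s) := fun s => congrArg (· s) h.eq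
  refine ⟨fun s hs => ?_, fun s hs => ?_⟩
  · rw [mem_posSpace_iff] at hs ⊢
    rw [h1, hs]
  · rw [mem_negSpace_iff] at hs ⊢
    rw [h1, hs, map_neg]

/-- Any `e_j` with `j ≠ i` is injective and exchanges the eigenspaces. -/
theorem posSpace_ne_bot_and_negSpace_ne_bot [Nontrivial S] (hk : 1 ≤ k) :
    posSpace i S ≠ ⊥ ∧ negSpace i S ≠ ⊥ := by
  have : Nontrivial (Fin (k + 1)) := Fin.nontrivial_iff_two_le.2 (by omega)
  obtain ⟨j, hj⟩ := exists_ne i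
  obtain ⟨hPN, hNP⟩ := map_negSpace_of_anticommute (S := S) (gen_anticommute hj.symm)
  have hinj : ∀ s : S, gen S j s = 0 → s = 0 := fun s hs => by
    rw [← gen_gen_apply j s, hs, map_zero]
  have hcompl := isCompl_posSpace_negSpace i S
  constructor
  · intro h
    have hN : negSpace i S = ⊤ := by simpa [h] using hcompl.sup_eq_top
    obtain ⟨s, hs⟩ := exists_ne (0 : S)
    have h1 := hNP s (by simp [hN])
    rw [h, Submodule.mem_bot] at h1
    exact hs (hinj s h1)
  · intro h
    have hP : posSpace i S = ⊤ := by simpa [h] using hcompl.sup_eq_top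
    obtain ⟨s, hs⟩ := exists_ne (0 : S)
    have h1 := hPN s (by simp [hP])
    rw [h, Submodule.mem_bot] at h1
    exact hs (hinj s h1)

theorem IsInvariant.commute {φ : End ℝ S} (h : IsInvariant i φ) (l j : Fin (k + 1)) (hl : l ≠ i)
    (hj : j ≠ i) : Commute (gen S l * gen S j) φ := by
  obtain ⟨l, rfl⟩ := Fin.exists_succAbove_eq hl
  obtain ⟨j, rfl⟩ := Fin.exists_succAbove_eq hj
  have h1 := h (e l * e j) (CliffordAlgebra.ι_mul_ι_mem_evenOdd_zero _ _ _)
  rw [map_mul, map_mul, incl_e, incl_e] at h1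
  exact h1

theorem rho_incl_volumeForm :
    rho (k + 1) S (incl i (volumeForm k)) = (List.ofFn fun j => gen S (i.succAbove j)).prod := by
  rw [incl_volumeForm, map_list_prod, List.map_ofFn]
  rfl

section Volume

variable (i S)

theorem pairwise_ofFn_gen :
    (List.ofFn fun j => gen S (i.succAbove j)).Pairwise Anticommute := by
  rw [List.pairwise_ofFn]
  exact fun j l hjl => gen_anticommute fun h => hjl.ne (Fin.succAbove_right_injective h)

theorem volume_mul_self :
    rho (k + 1) S (incl i (volumeForm k)) * rho (k + 1) S (incl i (volumeForm k)) =
      (-1) ^ k.choose 2 := by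
  rw [rho_incl_volumeForm, prod_mul_self _ (pairwise_ofFn_gen i S), List.length_ofFn]
  simp [List.mem_ofFn, gen_mul_self]

theorem gen_mul_volume_self :
    gen S i * rho (k + 1) S (incl i (volumeForm k)) =
      (-1) ^ k * (rho (k + 1) S (incl i (volumeForm k)) * gen S i) := by
  rw [rho_incl_volumeForm, mul_prod_of_anticommute, List.length_ofFn]
  simp only [List.mem_ofFn, forall_exists_index, forall_apply_eq_imp_iff]
  exact fun j => gen_anticommute (Fin.succAbove_ne i j).symm

theorem gen_mul_volume {j : Fin (k + 1)} (hj : j ≠ i) :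
    gen S j * rho (k + 1) S (incl i (volumeForm k)) =
      (-1) ^ (k + 1) * (rho (k + 1) S (incl i (volumeForm k)) * gen S j) := by
  obtain ⟨j, rfl⟩ := Fin.exists_succAbove_eq hj
  rw [rho_incl_volumeForm, mul_prod_of_mem _ _ (pairwise_ofFn_gen i S), List.length_ofFn]
  simp [List.mem_ofFn]

end Volume

variable (i S) in
theorem exists_isOffDiagonalMap [IsSimpleModule (Cl (k + 1)) S] :
    ∃ ϕ : End ℝ S, IsOffDiagonalMap i ϕ := by
  have h8 : (k + 1) % 8 < 8 := Nat.mod_lt _ (by norm_num)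
  rcases Nat.even_or_odd (k + 1) with hk | hk
  · rw [Nat.even_iff] at hk
    exact ⟨_, fun _ => rfl, by omega, by omega, by omega⟩
  rw [Nat.odd_iff] at hk
  by_cases h3 : (k + 1) % 8 = 3
  · obtain ⟨J, hJ, hJ2⟩ := exists_anticommuting_of_hasConjugation S (m := k + 1) (s := -1) <| by
      have := hasConjugation_three_mod_eight (V := S) ((k + 1) / 8)
      rwa [show 8 * ((k + 1) / 8) + 3 = k + 1 by omega] at this
    exact ⟨J, by omega, fun _ => ⟨hJ, by rw [IsComplexStructure, hJ2, neg_one_smul]⟩, by omega,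
      by omega⟩
  by_cases h7 : (k + 1) % 8 = 7
  · obtain ⟨J, hJ, hJ2⟩ := exists_anticommuting_of_hasConjugation S (m := k + 1) (s := 1) <| by
      have := hasConjugation_seven_mod_eight (V := S) ((k + 1) / 8)
      rwa [show 8 * ((k + 1) / 8) + 7 = k + 1 by omega] at this
    rw [one_smul] at hJ2
    exact ⟨J, by omega, by omega, fun _ => ⟨hJ, isParaComplexStructure_of_anticommute hJ2
      (gen_mul_self i) (isOddSchur_iff.1 hJ i)⟩, by omega⟩
  · exact ⟨0, by omega, by omega, by omega, fun _ => rfl⟩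

/-- For `k + 1 ≢ 1 (mod 4)` the off-diagonal map is invertible and anticommutes with `e_i`. -/
theorem IsOffDiagonalMap.properties {ϕ : End ℝ S} (h : IsOffDiagonalMap i ϕ)
    (hk : (k + 1) % 4 ≠ 1) :
    Anticommute (gen S i) ϕ ∧ (∃ ε : ℝ, ε * ε = 1 ∧ ϕ * ϕ = ε • 1) ∧
      ∀ l j, l ≠ i → j ≠ i → Commute (gen S l * gen S j) ϕ := by
  rcases Nat.even_or_odd (k + 1) with hk2 | hk2
  · obtain rfl := h.1 (Nat.even_iff.1 hk2)
    have hodd : Odd k := by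
      rw [Nat.even_iff] at hk2; rw [Nat.odd_iff]; omega
    refine ⟨?_, ⟨(-1) ^ k.choose 2, ?_, ?_⟩, fun l j hl hj => ?_⟩
    · rw [anticommute_iff, gen_mul_volume_self, hodd.neg_one_pow, neg_one_mul]
    · rw [← pow_add, Even.neg_one_pow ⟨_, rfl⟩]
    · rw [volume_mul_self]
      rcases neg_one_pow_eq_or ℝ (k.choose 2) with h | h <;>
      rcases Nat.even_or_odd (k.choose 2) with h' | h' <;> simp [h'.neg_one_pow]
    · have hc : ∀ l : Fin (k + 1), l ≠ i → Commute (gen S l) (rho (k + 1) S (incl i (volumeForm k))) := by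
        intro l hl
        rw [Commute, SemiconjBy, gen_mul_volume i S hl, hk2.neg_one_pow, one_mul]
      exact (hc l hl).mul_left (hc j hj)
  · have h37 : (∀ j : Fin (k + 1), Anticommute (gen S j) ϕ) ∧ ∃ ε : ℝ, ε * ε = 1 ∧ ϕ * ϕ = ε • 1 := by
      rw [Nat.odd_iff] at hk2
      rcases (by omega : (k + 1) % 8 = 3 ∨ (k + 1) % 8 = 7) with h3 | h7
      · obtain ⟨h1, h2⟩ := h.2.1 h3
        exact ⟨isOddSchur_iff.1 h1, -1, by norm_num, by rw [neg_one_smul]; exact h2⟩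
      · obtain ⟨h1, h2⟩ := h.2.2.1 h7
        exact ⟨isOddSchur_iff.1 h1, 1, by norm_num, by rw [one_smul]; exact h2.1⟩
    exact ⟨h37.1 i, h37.2, fun l j _ _ => ((h37.1 l).symm.commute_mul (h37.1 j).symm).symm⟩

theorem halfCorner_gen_mem (s : S) : halfCorner 1 (gen S i) s ∈ posSpace i S := by
  rw [mem_posSpace_iff, ← Module.End.mul_apply, mul_halfCorner (gen_mul_self i)
    (Commute.one_right _)]

theorem halfCorner_neg_gen_mem (s : S) : halfCorner 1 (-gen S i) s ∈ negSpace i S := by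
  rw [mem_negSpace_iff]
  have h := mul_halfCorner (P := (1 : End ℝ S)) (w := -gen S i)
    (by rw [neg_mul_neg, gen_mul_self]) (Commute.one_right _)
  rw [eq_neg_iff_add_eq_zero, add_comm, ← neg_neg (gen S i (_ : S)), ← sub_eq_add_neg, sub_eq_zero]
  exact (congrArg (· s) h).symm

theorem halfCorner_add_halfCorner_neg (w : End ℝ S) (s : S) :
    halfCorner 1 w s + halfCorner 1 (-w) s = s := by
  simp only [halfCorner_apply, Module.End.one_apply, LinearMap.neg_apply]
  module

/-- Both parts come from `exists_extension`, with `w = e_i` and `w = -e_i`. -/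
theorem exists_evenSchur_extension {φ : End ℝ S}
    (hφ : ∀ l j : Fin (k + 1), l ≠ i → j ≠ i → Commute (gen S l * gen S j) φ) :
    (∃ a : evenSchurAlgebra (k + 1) S, ∀ s ∈ posSpace i S,
      (a : End ℝ S) s = halfCorner 1 (gen S i) (φ s)) ∧
    ∃ d : evenSchurAlgebra (k + 1) S, ∀ s ∈ negSpace i S,
      (d : End ℝ S) s = halfCorner 1 (-gen S i) (φ s) := by
  constructor
  · obtain ⟨a, ha, ha'⟩ := exists_extension (gen S) i (gen S i) φ gen_mul_self (gen_mul_self i)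
      (Commute.refl _) (fun a h => h.symm) (fun l j h => gen_anticommute h)
      (fun l h => gen_anticommute h) hφ
    exact ⟨⟨a, mem_evenSchurAlgebra_iff.2 ha⟩, fun s hs => ha' s (mem_posSpace_iff.1 hs)⟩
  · obtain ⟨a, ha, ha'⟩ := exists_extension (gen S) i (-gen S i) φ gen_mul_self
      (by rw [neg_mul_neg, gen_mul_self])
      (Commute.refl _).neg_right (fun a h => by simpa using h.symm.neg_left)
      (fun l j h => gen_anticommute h)
      (fun l h => by
        have := (gen_anticommute (S := S) h).eq
        rw [anticommute_iff, mul_neg, neg_mul, this]) hφ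
    refine ⟨⟨a, mem_evenSchurAlgebra_iff.2 ha⟩, fun s hs => ha' s ?_⟩
    rw [LinearMap.neg_apply, mem_negSpace_iff.1 hs, neg_neg]

/-- For `k + 1 ≡ 1 (mod 4)` every invariant endomorphism preserves the eigenspaces of `e_i`. -/
theorem IsInvariant.commute_gen [IsSimpleModule (Cl (k + 1)) S] {φ : End ℝ S}
    (h : IsInvariant i φ) (hk : (k + 1) % 4 = 1) : Commute (gen S i) φ := by
  set ω := rho (k + 1) S (incl i (volumeForm k)) with hω
  obtain ⟨n, rfl⟩ : ∃ n, k = 4 * n := ⟨k / 4, by omega⟩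
  have hev : Even (4 * n) := ⟨2 * n, by omega⟩
  have hchoose : Even ((4 * n).choose 2) := by
    rw [Nat.choose_two_right, mul_assoc, show 4 * (n * (4 * n - 1)) = 2 * (2 * (n * (4 * n - 1))) by
      ring, Nat.mul_div_cancel_left _ two_pos]
    exact even_two_mul _
  have hωω : ω * ω = 1 := by rw [hω, volume_mul_self, hchoose.neg_one_pow]
  have hωi : Commute (gen S i) ω := by
    rw [Commute, SemiconjBy, hω, gen_mul_volume_self, hev.neg_one_pow, one_mul]
  have hωφ : Commute ω φ := h _ (volumeForm_mem_even hev)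
  -- Up to sign, `ω e_i` is the volume element in odd dimension, hence central.
  have hzc : ∀ j : Fin (4 * n + 1), Commute (gen S j) (ω * gen S i) := by
    intro j
    by_cases hj : j = i
    · subst hj; exact hωi.mul_right (Commute.refl _)
    · refine Anticommute.commute_mul ?_ (gen_anticommute hj)
      rw [anticommute_iff, hω, gen_mul_volume i S hj, hev.add_one.neg_one_pow, neg_one_mul]
  have hz : (ω * gen S i) * (ω * gen S i) = 1 := by
    rw [mul_self_mul_of_commute hωi.symm, hωω, gen_mul_self, one_mul]
  have hgen : gen S i = ω * (ω * gen S i) := by rw [← mul_assoc, hωω, one_mul]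
  rcases eq_one_or_eq_neg_one_of_central hz hzc with h1 | h1
  · rw [hgen, h1, mul_one]; exact hωφ
  · rw [hgen, h1, mul_neg_one]; exact hωφ.neg_left

theorem IsInvariant.exists_isBlockMatrix [IsSimpleModule (Cl (k + 1)) S] {ϕ φ : End ℝ S}
    (hϕ : IsOffDiagonalMap i ϕ) (hφ : IsInvariant i φ) :
    ∃ a b c d : evenSchurAlgebra (k + 1) S, IsBlockMatrix (posSpace i S) (negSpace i S) φ
      (a : End ℝ S) ((b : End ℝ S) * ϕ) ((c : End ℝ S) * ϕ) (d : End ℝ S) := by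
  obtain ⟨⟨a, ha⟩, d, hd⟩ := exists_evenSchur_extension hφ.commute
  by_cases hk : (k + 1) % 4 = 1
  · obtain rfl := hϕ.2.2.2 (by omega)
    obtain ⟨hP, hN⟩ := map_posSpace_of_commute (hφ.commute_gen hk)
    refine ⟨a, 0, 0, d, fun s hs => ?_, fun s hs => ?_⟩
    · have h1 : (a : End ℝ S) s = φ s := by
        rw [ha s hs]
        exact (halfCorner_apply_eq_iff (mul_one 1) (gen_mul_self i) (Commute.one_right _) _).2
          ⟨rfl, mem_posSpace_iff.1 (hP s hs)⟩
      simp [h1, hP s hs]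
    · have h1 : (d : End ℝ S) s = φ s := by
        rw [hd s hs]
        exact (halfCorner_apply_eq_iff (mul_one 1) (by rw [neg_mul_neg, gen_mul_self])
          (Commute.one_right _) _).2
          ⟨rfl, by rw [LinearMap.neg_apply, mem_negSpace_iff.1 (hN s hs), neg_neg]⟩
      simp [h1, hN s hs]
  · obtain ⟨hanti, ⟨ε, hε, hsq⟩, hcomm⟩ := hϕ.properties hk
    obtain ⟨hPN, hNP⟩ := map_negSpace_of_anticommute hanti
    -- The off-diagonal blocks of `φ` become diagonal blocks of `φ ϕ`. As `ϕ² = ε`, composing with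
    -- `ϕ` once more gives `ε` times the original block, which accounts for the factors `ε` below.
    obtain ⟨⟨b, hb⟩, c, hc⟩ := exists_evenSchur_extension (i := i) (φ := φ * ϕ)
      fun l j hl hj => (hφ.commute l j hl hj).mul_right (hcomm l j hl hj)
    have hϕϕ : ∀ s, ϕ (ϕ s) = ε • s := fun s => congrArg (· s) hsq
    have hc' : ∀ s ∈ posSpace i S, (((ε • c : evenSchurAlgebra (k + 1) S) : End ℝ S) * ϕ) s =
        halfCorner 1 (-gen S i) (φ s) := by
      intro s hs
      rw [Module.End.mul_apply, Subalgebra.coe_smul, LinearMap.smul_apply, hc _ (hPN s hs),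
        Module.End.mul_apply, hϕϕ, map_smul, map_smul, smul_smul, hε, one_smul]
    have hb' : ∀ s ∈ negSpace i S, (((ε • b : evenSchurAlgebra (k + 1) S) : End ℝ S) * ϕ) s =
        halfCorner 1 (gen S i) (φ s) := by
      intro s hs
      rw [Module.End.mul_apply, Subalgebra.coe_smul, LinearMap.smul_apply, hb _ (hNP s hs),
        Module.End.mul_apply, hϕϕ, map_smul, map_smul, smul_smul, hε, one_smul]
    refine ⟨a, ε • b, ε • c, d, fun s hs => ?_, fun s hs => ?_⟩
    · rw [ha s hs, hc' s hs, halfCorner_add_halfCorner_neg]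
      exact ⟨halfCorner_gen_mem _, halfCorner_neg_gen_mem _, rfl⟩
    · rw [hd s hs, hb' s hs, halfCorner_add_halfCorner_neg]
      exact ⟨halfCorner_gen_mem _, halfCorner_neg_gen_mem _, rfl⟩

end Restriction

/-! ### Uniqueness of the blocks as maps on the summands. -/

section BlockMatrix

variable {S : Type*} [AddCommGroup S] [Module ℝ S]

theorem IsBlockMatrix.unique {P N : Submodule ℝ S} (h : Disjoint P N)
    {φ A B C D A' B' C' D' : End ℝ S} (h1 : IsBlockMatrix P N φ A B C D)
    (h2 : IsBlockMatrix P N φ A' B' C' D') :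
    (∀ s ∈ P, A s = A' s ∧ C s = C' s) ∧ ∀ s ∈ N, B s = B' s ∧ D s = D' s := by
  have key : ∀ x ∈ P, ∀ y ∈ N, ∀ x' ∈ P, ∀ y' ∈ N, x + y = x' + y' → x = x' ∧ y = y' := by
    intro x hx y hy x' hx' y' hy' hxy
    have h3 : x - x' = y' - y := by rw [sub_eq_sub_iff_add_eq_add, hxy, add_comm]
    have h4 := Submodule.disjoint_def.1 h _ (sub_mem hx hx') (h3 ▸ sub_mem hy' hy)
    exact ⟨sub_eq_zero.1 h4, (sub_eq_zero.1 (h3 ▸ h4)).symm⟩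
  refine ⟨fun s hs => ?_, fun s hs => ?_⟩
  · obtain ⟨hA, hC, hs1⟩ := h1.1 s hs
    obtain ⟨hA', hC', hs2⟩ := h2.1 s hs
    exact key _ hA _ hC _ hA' _ hC' (hs1.symm.trans hs2)
  · obtain ⟨hA, hC, hs1⟩ := h1.2 s hs
    obtain ⟨hA', hC', hs2⟩ := h2.2 s hs
    exact key _ hA _ hC _ hA' _ hC' (hs1.symm.trans hs2)

end BlockMatrix

end Spin

theorem theorem2p4 (k : ℕ) (i : Fin (k + 1)) (S : Type*) [AddCommGroup S] [Module ℝ S]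
    [Module (Spin.Cl (k + 1)) S] [IsScalarTower ℝ (Spin.Cl (k + 1)) S]
    [IsSimpleModule (Spin.Cl (k + 1)) S] :
    IsCompl (Spin.posSpace i S) (Spin.negSpace i S) ∧
    (1 ≤ k → Spin.posSpace i S ≠ ⊥ ∧ Spin.negSpace i S ≠ ⊥) ∧
    (∃ ϕ : Module.End ℝ S, Spin.IsOffDiagonalMap i ϕ) ∧
    ∀ ϕ : Module.End ℝ S, Spin.IsOffDiagonalMap i ϕ →
      (∀ s ∈ Spin.posSpace i S, ϕ s ∈ Spin.negSpace i S) ∧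
      (∀ s ∈ Spin.negSpace i S, ϕ s ∈ Spin.posSpace i S) ∧
      ∀ φ : Module.End ℝ S, Spin.IsInvariant i φ →
        (∃ a b c d : Spin.evenSchurAlgebra (k + 1) S,
          Spin.IsBlockMatrix (Spin.posSpace i S) (Spin.negSpace i S) φ
            (a : Module.End ℝ S) ((b : Module.End ℝ S) * ϕ)
            ((c : Module.End ℝ S) * ϕ) (d : Module.End ℝ S)) ∧
        (∀ a b c d a' b' c' d' : Spin.evenSchurAlgebra (k + 1) S,
          Spin.IsBlockMatrix (Spin.posSpace i S) (Spin.negSpace i S) φ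
            (a : Module.End ℝ S) ((b : Module.End ℝ S) * ϕ)
            ((c : Module.End ℝ S) * ϕ) (d : Module.End ℝ S) →
          Spin.IsBlockMatrix (Spin.posSpace i S) (Spin.negSpace i S) φ
            (a' : Module.End ℝ S) ((b' : Module.End ℝ S) * ϕ)
            ((c' : Module.End ℝ S) * ϕ) (d' : Module.End ℝ S) →
          (Spin.posSpace i S ≠ ⊥ → a = a') ∧ (Spin.negSpace i S ≠ ⊥ → d = d') ∧
            ((k + 1) % 4 ≠ 1 → b = b' ∧ c = c')) := by
  have : Nontrivial S := IsSimpleModule.nontrivial (Spin.Cl (k + 1)) S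
  have hcompl := Spin.isCompl_posSpace_negSpace i S
  refine ⟨hcompl, Spin.posSpace_ne_bot_and_negSpace_ne_bot, Spin.exists_isOffDiagonalMap i S,
    fun ϕ hϕ => ?_⟩
  have hmap : (∀ s ∈ Spin.posSpace i S, ϕ s ∈ Spin.negSpace i S) ∧
      ∀ s ∈ Spin.negSpace i S, ϕ s ∈ Spin.posSpace i S := by
    by_cases hk : (k + 1) % 4 = 1
    · obtain rfl := hϕ.2.2.2 (by omega)
      simp
    · exact Spin.map_negSpace_of_anticommute (hϕ.properties hk).1
  refine ⟨hmap.1, hmap.2, fun φ hφ => ⟨hφ.exists_isBlockMatrix hϕ, ?_⟩⟩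
  intro a b c d a' b' c' d' h h'
  obtain ⟨hP, hN⟩ := h.unique hcompl.disjoint h'
  refine ⟨fun hne => ?_, fun hne => ?_, fun hk => ?_⟩
  · obtain ⟨s, hs, hs0⟩ := Submodule.exists_mem_ne_zero_of_ne_bot hne
    exact Spin.eq_of_evenSchur_of_apply_eq hs0 (hP s hs).1
  · obtain ⟨s, hs, hs0⟩ := Submodule.exists_mem_ne_zero_of_ne_bot hne
    exact Spin.eq_of_evenSchur_of_apply_eq hs0 (hN s hs).2
  · obtain ⟨-, ⟨ε, hε, hsq⟩, -⟩ := hϕ.properties hk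
    -- Injectivity of `ϕ` provides a nonzero vector `ϕ t` at which `b` and `b'` agree, and likewise
    -- `ϕ s` for `c` and `c'`.
    have hϕ0 : ∀ s, s ≠ 0 → ϕ s ≠ 0 := by
      intro s hs h0
      have h1 : ϕ (ϕ s) = ε • s := congrArg (· s) hsq
      rw [h0, map_zero] at h1
      rcases smul_eq_zero.1 h1.symm with h2 | h2
      · simp [h2] at hε
      · exact hs h2
    -- The case `k = 0` is excluded, since there `m = 1 ≡ 1 (mod 4)`.
    obtain ⟨hne, hne'⟩ := Spin.posSpace_ne_bot_and_negSpace_ne_bot (i := i) (S := S)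
      (by omega : 1 ≤ k)
    obtain ⟨s, hs, hs0⟩ := Submodule.exists_mem_ne_zero_of_ne_bot hne
    obtain ⟨t, ht, ht0⟩ := Submodule.exists_mem_ne_zero_of_ne_bot hne'
    exact ⟨Spin.eq_of_evenSchur_of_apply_eq (hϕ0 t ht0) (hN t ht).1,
      Spin.eq_of_evenSchur_of_apply_eq (hϕ0 s hs0) (hP s hs).2⟩
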